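/- Let $d\ge 3$ and $\mathbf p=(p_1,\dots,p_d)\in[0,1]^d$. For each $i\in\{1,\dots,d\}$ and each $w\in\mathbb Z^d$ with $w_i=0$, remove independently, with probability $1-p_i$, all the vertices of the line $\{w+ze_i : z\in\mathbb Z\}$ from $\mathbb Z^d$, where $e_1,\dots,e_d$ is the standard basis. Let $\mathcal V\subset\mathbb Z^d$ be the random set of vertices that have not been removed (the vacant set), and let $\mathbb P_{\mathbf p}$ be its law. Let $N\in\{0,1,2,\dots\}\cup\{\infty\}$ be the number of infinite connected components of $\mathcal V$ with respect to nearest-neighbour adjacency in $\mathbb Z^d$. Then there is a constant $c\in\{0,1,\infty\}$ (depending on $d$ and $\mathbf p$) such that $N=c$ almost surely under $\mathbb P_{\mathbf p}$. -/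

import Mathlib

open MeasureTheory ProbabilityTheory

namespace LinePercolation

/-- The nearest-neighbour graph on `ℤ^d`: two sites are adjacent iff their `ℓ¹`-distance is `1`. -/
def latticeGraph (d : ℕ) : SimpleGraph (Fin d → ℤ) where
  Adj v w := ∑ i, |v i - w i| = 1
  symm := ⟨fun v w h => by
    rw [← h]
    exact Finset.sum_congr rfl fun i _ => abs_sub_comm _ _⟩
  loopless := ⟨fun v h => by simp at h⟩

/-- The coordinate hyperplane of `ℤ^d` orthogonal to the `i`-th basis vector. Its points index
the lines parallel to that vector. -/
abbrev Hyperplane (d : ℕ) (i : Fin d) : Type := {w : Fin d → ℤ // w i = 0}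

/-- The orthogonal projection of `ℤ^d` onto the `i`-th coordinate hyperplane. -/
def proj {d : ℕ} (i : Fin d) (v : Fin d → ℤ) : Hyperplane d i :=
  ⟨Function.update v i 0, Function.update_self i 0 v⟩

/-- The law on `∏ i, {0,1}^(Hyperplane i)` under which all lines are independent and a line
parallel to the `i`-th axis is kept (`true`) with probability `p i` and removed (`false`) with
probability `1 - p i`. -/
noncomputable def lineMeasure (d : ℕ) (p : Fin d → unitInterval) :
    Measure ((i : Fin d) → Hyperplane d i → Bool) :=
  Measure.pi fun i => Measure.infinitePi fun _ : Hyperplane d i => bernoulliMeasure true false (p i)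

/-- The site configuration given by the states of the lines: a site is open (`true`) iff all the
lines through it that are parallel to a coordinate axis are kept. -/
def siteConfig {d : ℕ} (ω : (i : Fin d) → Hyperplane d i → Bool) (v : Fin d → ℤ) : Bool :=
  decide (∀ i, ω i (proj i v) = true)

theorem measurable_siteConfig (d : ℕ) : Measurable (siteConfig (d := d)) := by
  refine measurable_pi_lambda _ fun v => measurable_to_bool ?_
  have h : (fun ω : (i : Fin d) → Hyperplane d i → Bool => siteConfig ω v) ⁻¹' {true} =
      ⋂ i, {ω | ω i (proj i v) = true} := by
    ext ω
    simp [siteConfig]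
  rw [h]
  refine MeasurableSet.iInter fun i => ?_
  have hm : Measurable fun ω : (i : Fin d) → Hyperplane d i → Bool => ω i (proj i v) := by
    fun_prop
  exact hm (measurableSet_singleton true)

/-- Bernoulli line percolation on `ℤ^d` with parameter vector `p`: the law of the site
configuration on `{0,1}^(ℤ^d)`. -/
noncomputable def bernoulliLinePercolation (d : ℕ) (p : Fin d → unitInterval) :
    Measure ((Fin d → ℤ) → Bool) :=
  (lineMeasure d p).map siteConfig

instance (d : ℕ) (p : Fin d → unitInterval) : IsProbabilityMeasure (lineMeasure d p) := by
  unfold lineMeasure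
  infer_instance

instance (d : ℕ) (p : Fin d → unitInterval) :
    IsProbabilityMeasure (bernoulliLinePercolation d p) :=
  Measure.isProbabilityMeasure_map (measurable_siteConfig d).aemeasurable

/-- The vacant set of a site configuration: the set of open sites. -/
def vacantSet {d : ℕ} (η : (Fin d → ℤ) → Bool) : Set (Fin d → ℤ) :=
  {v | η v = true}

/-- The number `N` (in `ℕ ∪ {∞}`) of infinite connected components of the vacant set. -/
noncomputable def numInfiniteClusters {d : ℕ} (η : (Fin d → ℤ) → Bool) : ℕ∞ :=
  Set.encard {C : ((latticeGraph d).induce (vacantSet η)).ConnectedComponent | C.supp.Infinite}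

end LinePercolation

/-! If some `p i = 0`, every line in direction `i` is removed and there is no cluster at all.
Otherwise every line is kept with positive probability. Diagonal translations move every line off
any given one, so they are mixing for the product measure on lines. The translation-invariant `N` is
therefore almost surely constant, and it remains to exclude `N = k` with `2 ≤ k < ∞`.

With positive probability, some fixed `k` sites lie in distinct infinite clusters. Open a finite set
`S` of lines joining them. The new law is the old one conditioned on `S` being open, hence
absolutely continuous, so `N = k` still holds; yet the old infinite clusters have merged into one.
Opening a line changes infinitely many sites, so the missing clusters might be new ones, free of old
infinite sites. Two facts rule this out. (a) By mixing, conditioning on `S` being open has no effect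
on far events: the probability that the `n`-th translate of `y` is in an infinite cluster only after
opening tends to `0` (`tendsto_measureReal_new`). By Borel–Cantelli along a suitable sequence `j`,
only finitely many translates of each `y` are newly infinite (`ae_finite_new`). (b) When `N < ∞`,
stationarity and the pigeonhole principle show that every infinite cluster contains infinitely many
terms of the sequence of translates along `j` of some site (`ae_notMem_sparseSites`). A new cluster
would contradict (a) and (b) together. -/

namespace LinePercolation

/-! ### Clusters of a subset of a graph. -/

section Graph

variable {X : Type*} (G : SimpleGraph X)

/-- Two sites are linked in `V` if both lie in `V` and are joined by a path inside `V`. -/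
def Linked (V : Set X) (x y : X) : Prop :=
  ∃ (hx : x ∈ V) (hy : y ∈ V), (G.induce V).Reachable ⟨x, hx⟩ ⟨y, hy⟩

/-- The union of the infinite clusters of `V`. -/
def infiniteSites (V : Set X) : Set X := {x | {y | Linked G V x y}.Infinite}

/-- Two sites are joined by a path of length `n` inside `V`. -/
def LinkedIn (V : Set X) : ℕ → X → X → Prop
  | 0, x, y => x ∈ V ∧ x = y
  | n + 1, x, y => ∃ z, LinkedIn V n x z ∧ G.Adj z y ∧ y ∈ V

variable {G} {V W : Set X} {x y z : X}

theorem Linked.refl (hx : x ∈ V) : Linked G V x x := ⟨hx, hx, .rfl⟩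

theorem Linked.symm (h : Linked G V x y) : Linked G V y x :=
  let ⟨hx, hy, h⟩ := h; ⟨hy, hx, h.symm⟩

theorem Linked.trans (h : Linked G V x y) (h' : Linked G V y z) : Linked G V x z :=
  let ⟨hx, _, h⟩ := h; let ⟨_, hz, h'⟩ := h'; ⟨hx, hz, h.trans h'⟩

theorem Linked.mono (hVW : V ⊆ W) (h : Linked G V x y) : Linked G W x y :=
  let ⟨hx, hy, h⟩ := h
  ⟨hVW hx, hVW hy, h.map (SimpleGraph.induceHomOfLE G hVW).toHom⟩

theorem linked_of_adj (h : G.Adj x y) (hx : x ∈ V) (hy : y ∈ V) : Linked G V x y :=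
  ⟨hx, hy, SimpleGraph.Adj.reachable (G := G.induce V) (u := ⟨x, hx⟩) (v := ⟨y, hy⟩) h⟩

/-- Path length makes linking a countable union of inductively defined relations, as needed for
measurability and for transport along automorphisms. -/
theorem linked_iff_exists_linkedIn : Linked G V x y ↔ ∃ n, LinkedIn G V n x y := by
  constructor
  · rintro ⟨hx, hy, ⟨w⟩⟩
    suffices ∀ (a b : V), (G.induce V).Walk a b → ∃ n, LinkedIn G V n b a from
      this _ _ w.reverse
    intro a b w
    induction w with
    | nil => exact ⟨0, Subtype.property _, rfl⟩
    | cons h _ ih =>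
      obtain ⟨n, hn⟩ := ih
      exact ⟨n + 1, _, hn, h.symm, Subtype.property _⟩
  · rintro ⟨n, hn⟩
    induction n generalizing y with
    | zero => obtain ⟨hx, rfl⟩ := hn; exact .refl hx
    | succ n ih =>
      obtain ⟨z, hz, hadj, hy⟩ := hn
      have h := ih hz
      exact h.trans (linked_of_adj hadj h.2.1 hy)

theorem linked_of_walk (w : G.Walk x y) (h : ∀ z ∈ w.support, z ∈ V) : Linked G V x y :=
  ⟨h _ w.start_mem_support, h _ w.end_mem_support, ⟨w.induce V h⟩⟩

theorem mem_of_mem_infiniteSites (hx : x ∈ infiniteSites G V) : x ∈ V :=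
  let ⟨_, h⟩ := hx.nonempty; h.1

theorem infiniteSites_mono (hVW : V ⊆ W) : infiniteSites G V ⊆ infiniteSites G W :=
  fun _ hx => Set.Infinite.mono (fun _ hy => Linked.mono hVW hy) hx

theorem Linked.mem_infiniteSites (h : Linked G V x y) (hx : x ∈ infiniteSites G V) :
    y ∈ infiniteSites G V :=
  Set.Infinite.mono (fun _ hz => h.symm.trans hz) hx

theorem linked_equiv_iff (e : G ≃g G) : Linked G (e ⁻¹' V) x y ↔ Linked G V (e x) (e y) := by
  simp only [linked_iff_exists_linkedIn]
  refine exists_congr fun n => ?_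
  induction n generalizing y with
  | zero => simp [LinkedIn]
  | succ n ih =>
    simp only [LinkedIn, ih]
    refine e.toEquiv.exists_congr fun a => ?_
    exact and_congr .rfl (and_congr e.map_rel_iff.symm .rfl)

theorem mem_infiniteSites_equiv_iff (e : G ≃g G) :
    x ∈ infiniteSites G (e ⁻¹' V) ↔ e x ∈ infiniteSites G V := by
  have : {y | Linked G (e ⁻¹' V) x y} = e ⁻¹' {y | Linked G V (e x) y} := by
    ext y; exact linked_equiv_iff e
  rw [infiniteSites, infiniteSites, Set.mem_ofPred_eq, Set.mem_ofPred_eq, this]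
  exact ⟨fun h hf => h (hf.preimage e.injective.injOn),
    fun h => h.preimage (by simp [e.surjective.range_eq])⟩

/-- A finite set of sites in pairwise different infinite clusters of `V`. -/
def IsSeparated (G : SimpleGraph X) (V : Set X) (F : Finset X) : Prop :=
  (∀ x ∈ F, x ∈ infiniteSites G V) ∧ ∀ x ∈ F, ∀ y ∈ F, Linked G V x y → x = y

theorem supp_infinite_iff (hx : x ∈ V) :
    ((G.induce V).connectedComponentMk ⟨x, hx⟩).supp.Infinite ↔ x ∈ infiniteSites G V := by
  have : {y | Linked G V x y} =
      Subtype.val '' ((G.induce V).connectedComponentMk ⟨x, hx⟩).supp := by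
    ext y
    simp only [Set.mem_ofPred_eq, Set.mem_image, SimpleGraph.ConnectedComponent.mem_supp_iff,
      SimpleGraph.ConnectedComponent.eq, Subtype.exists, exists_and_right, exists_eq_right]
    exact ⟨fun ⟨_, hy, h⟩ => ⟨hy, h.symm⟩, fun ⟨hy, h⟩ => ⟨hx, hy, h.symm⟩⟩
  rw [infiniteSites, Set.mem_ofPred_eq, this, Set.infinite_image_iff Subtype.val_injective.injOn]

/-- The type of components varies with `V`. Finite sets of representatives replace it by a
quantifier over a fixed type, countable when `X` is. -/
theorem natCast_le_encard_infinite_components_iff (n : ℕ) :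
    (n : ℕ∞) ≤ Set.encard {C : (G.induce V).ConnectedComponent | C.supp.Infinite} ↔
      ∃ F : Finset X, F.card = n ∧ IsSeparated G V F := by
  classical
  constructor
  · intro h
    obtain ⟨t, ht, hc⟩ := Set.exists_subset_encard_eq h
    have hfin : t.Finite := Set.finite_of_encard_eq_coe hc
    have hout : ∀ C : (G.induce V).ConnectedComponent,
        (G.induce V).connectedComponentMk C.out = C := fun C => C.out_eq
    have hinj : Function.Injective fun C : (G.induce V).ConnectedComponent => (C.out : X) := by
      intro C D h
      rw [← hout C, ← hout D, Subtype.ext h]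
    refine ⟨hfin.toFinset.image fun C => (C.out : X), ?_, ?_, ?_⟩
    · rw [Finset.card_image_of_injective _ hinj, ← Set.ncard_eq_toFinset_card t hfin,
        Set.ncard_def, hc, ENat.toNat_natCast]
    · simp only [Finset.mem_image, Set.Finite.mem_toFinset]
      rintro _ ⟨C, hC, rfl⟩
      rw [← supp_infinite_iff C.out.2, hout C]
      exact ht hC
    · simp only [Finset.mem_image, Set.Finite.mem_toFinset]
      rintro _ ⟨C, hC, rfl⟩ _ ⟨D, hD, rfl⟩ ⟨_, _, h⟩
      have := SimpleGraph.ConnectedComponent.eq.2 h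
      rw [hout C, hout D] at this
      rw [this]
  · rintro ⟨F, rfl, hF, hF'⟩
    have hmem : ∀ x ∈ F, x ∈ V := fun x hx => mem_of_mem_infiniteSites (hF x hx)
    let f : F → (G.induce V).ConnectedComponent := fun x =>
      (G.induce V).connectedComponentMk ⟨x, hmem x x.2⟩
    have hf : Function.Injective f := fun x y h =>
      Subtype.ext (hF' x x.2 y y.2 ⟨_, _, SimpleGraph.ConnectedComponent.eq.1 h⟩)
    calc (F.card : ℕ∞) = (Set.univ : Set F).encard := by simp
      _ = (Set.range f).encard := by rw [← Set.image_univ, hf.encard_image]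
      _ ≤ _ := Set.encard_le_encard <| by
        rintro _ ⟨x, rfl⟩
        exact (supp_infinite_iff _).2 (hF x x.2)

theorem IsSeparated.insert [DecidableEq X] {F : Finset X} (hF : IsSeparated G V F)
    (hx : x ∈ infiniteSites G V) (h : ∀ y ∈ F, ¬ Linked G V x y) :
    IsSeparated G V (insert x F) := by
  refine ⟨fun y hy => ?_, fun y hy z hz hl => ?_⟩
  · rcases Finset.mem_insert.1 hy with rfl | hy
    exacts [hx, hF.1 y hy]
  · rw [Finset.mem_insert] at hy hz
    rcases hy with rfl | hy <;> rcases hz with rfl | hz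
    · rfl
    · exact (h z hz hl).elim
    · exact (h y hy hl.symm).elim
    · exact hF.2 y hy z hz hl

end Graph

/-! ### Product measures: mixing under shifts and opening finitely many coordinates. -/

section Mixing

open Filter Topology

variable {Ω : Type*} [mΩ : MeasurableSpace Ω]

/-- Setwise convergence of measures dominated by a finite measure can be checked on a `π`-system
generating the `σ`-algebra. -/
theorem tendsto_measureReal_of_piSystem {m : ℕ → Measure Ω} {ν μ : Measure Ω}
    [∀ n, IsFiniteMeasure (m n)] [IsFiniteMeasure ν] [IsFiniteMeasure μ]
    {s : Set (Set Ω)} (hs : mΩ = MeasurableSpace.generateFrom s) (hpi : IsPiSystem s)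
    (hm : ∀ n, m n ≤ μ)
    (huniv : Tendsto (fun n => (m n).real Set.univ) atTop (𝓝 (ν.real Set.univ)))
    (hbasic : ∀ A ∈ s, Tendsto (fun n => (m n).real A) atTop (𝓝 (ν.real A)))
    {A : Set Ω} (hA : MeasurableSet A) :
    Tendsto (fun n => (m n).real A) atTop (𝓝 (ν.real A)) := by
  induction A, hA using MeasurableSpace.induction_on_inter hs hpi with
  | empty => simp
  | basic t ht => exact hbasic t ht
  | compl t ht ih =>
    simp only [measureReal_compl ht]
    exact huniv.sub ih
  | iUnion f hd hf ih =>
    have hsum : ∀ (ρ : Measure Ω) [IsFiniteMeasure ρ], Summable (fun i => ρ.real (f i)) ∧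
        ρ.real (⋃ i, f i) = ∑' i, ρ.real (f i) := by
      intro ρ _
      have h := measure_iUnion (μ := ρ) hd hf
      refine ⟨ENNReal.summable_toReal (h ▸ measure_ne_top _ _), ?_⟩
      rw [Measure.real, h, ENNReal.tsum_toReal_eq fun i => measure_ne_top _ _]
      rfl
    simp only [(hsum _).2]
    -- The bound `m n ≤ μ` provides the summable majorant `μ.real (f i)`.
    refine tendsto_tsum_of_dominated_convergence (hsum μ).1 ih (.of_forall fun n i => ?_)
    rw [Real.norm_of_nonneg measureReal_nonneg]
    exact ENNReal.toReal_mono (measure_ne_top _ _) (hm n _)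

variable {ι : Type*} (ν : ι → Measure Bool) [∀ i, IsProbabilityMeasure (ν i)]

/-- The `σ`-algebra generated by the coordinates in `T`. -/
@[reducible]
def coordinates (T : Set ι) : MeasurableSpace (ι → Bool) :=
  ⨆ i ∈ T, MeasurableSpace.comap (fun ω : ι → Bool => ω i) ⊤

theorem indep_coordinates {S T : Set ι} (h : Disjoint S T) :
    Indep (coordinates S) (coordinates T) (Measure.infinitePi ν) :=
  indep_iSup_of_disjoint (fun i => (measurable_pi_apply i).comap_le)
    (iIndepFun_infinitePi (X := fun _ b => b) (P := ν) fun _ => measurable_id) h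

theorem measurable_coordinates {T : Set ι} {i : ι} (hi : i ∈ T) :
    Measurable[coordinates T] fun ω : ι → Bool => ω i :=
  Measurable.mono (comap_measurable _) (le_iSup₂_of_le i hi le_rfl) le_rfl

/-- Configurations modified by opening all coordinates in `S`. -/
noncomputable def openOn (S : Finset ι) (ω : ι → Bool) (i : ι) : Bool :=
  open Classical in if i ∈ S then true else ω i

variable {ν}

/-- All coordinates in `S` are open. -/
def allOpen (S : Finset ι) : Set (ι → Bool) := {ω | ∀ i ∈ S, ω i = true}

theorem allOpen_eq_pi (S : Finset ι) :
    allOpen S = Set.pi (S : Set ι) fun _ => {true} := by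
  ext ω; simp [allOpen]

theorem measurableSet_allOpen (S : Finset ι) : MeasurableSet (allOpen S) := by
  rw [allOpen_eq_pi]
  exact .pi S.countable_toSet fun _ _ => measurableSet_singleton _

theorem measure_allOpen_ne_zero (h : ∀ i, ν i {true} ≠ 0) (S : Finset ι) :
    Measure.infinitePi ν (allOpen S) ≠ 0 := by
  rw [allOpen_eq_pi, Measure.infinitePi_pi ν fun _ _ => measurableSet_singleton _]
  exact Finset.prod_ne_zero_iff.2 fun i _ => h i

/-- The event `openOn S ⁻¹' A` depends only on coordinates outside `S`, so it is independent of
`allOpen S`, on which `openOn S` is the identity. Thus opening `S` amounts to conditioning on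
`allOpen S`. -/
theorem measure_openOn_preimage_mul (S : Finset ι) {A : Set (ι → Bool)} (hA : MeasurableSet A) :
    Measure.infinitePi ν (openOn S ⁻¹' A) * Measure.infinitePi ν (allOpen S) = Measure.infinitePi ν (A ∩ allOpen S) := by
  have hind := indep_coordinates ν (S := (S : Set ι)ᶜ) (T := S) disjoint_compl_left
  rw [Indep_iff] at hind
  rw [← hind (openOn S ⁻¹' A) (allOpen S)]
  · congr 1
    ext ω
    refine and_congr_left fun h => ?_
    have : openOn S ω = ω := by
      ext i
      by_cases hi : i ∈ S
      · simp [openOn, hi, h i hi]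
      · simp [openOn, hi]
    simp [this]
  · refine @measurable_pi_lambda _ _ _ (coordinates _) _ _ (fun i => ?_) A hA
    by_cases hi : i ∈ S
    · simp only [openOn, hi, if_true]
      exact @measurable_const _ _ _ (coordinates _) _
    · simp only [openOn, hi, if_false]
      exact measurable_coordinates (by simpa using hi)
  · rw [allOpen_eq_pi]
    have : Set.pi (S : Set ι) (fun _ => {true}) = ⋂ i ∈ S, (fun ω : ι → Bool => ω i) ⁻¹' {true} := by
      ext; simp
    rw [this]
    exact @Finset.measurableSet_biInter _ _ (coordinates _) _ S fun i hi =>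
      measurable_coordinates (T := (S : Set ι)) hi (measurableSet_singleton true)

theorem measure_eq_zero_of_openOn_preimage (h : ∀ i, ν i {true} ≠ 0) (S : Finset ι)
    {A : Set (ι → Bool)} (hA : MeasurableSet A) (h0 : Measure.infinitePi ν A = 0) : Measure.infinitePi ν (openOn S ⁻¹' A) = 0 := by
  have h1 := measure_openOn_preimage_mul (ν := ν) S hA
  rw [measure_mono_null Set.inter_subset_left h0] at h1
  exact (mul_eq_zero.1 h1).resolve_right (measure_allOpen_ne_zero h S)

theorem measurePreserving_comp {σ : ι → ι} (hσ : σ.Injective) (hν : ∀ i, ν (σ i) = ν i) :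
    MeasurePreserving (fun (ω : ι → Bool) i => ω (σ i)) (Measure.infinitePi ν) (Measure.infinitePi ν) where
  measurable := by fun_prop
  map_eq := by
    rw [Measure.map_infinitePi_infinitePi_of_inj hσ]
    simp only [hν]

/-- A sequence of coordinate shifts that eventually moves every coordinate away from any given
finite set is mixing for a product measure. -/
theorem tendsto_measureReal_shift_inter {σ : ℕ → ι → ι} (hσ : ∀ n, (σ n).Injective)
    (hν : ∀ n i, ν (σ n i) = ν i) (hmix : ∀ i j, ∀ᶠ n in atTop, σ n i ≠ j)
    {A B : Set (ι → Bool)} (hA : MeasurableSet A) (hB : MeasurableSet B) :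
    Tendsto (fun n => (Measure.infinitePi ν).real ((fun ω i => ω (σ n i)) ⁻¹' A ∩ B)) atTop
      (𝓝 ((Measure.infinitePi ν).real A * (Measure.infinitePi ν).real B)) := by
  have hmp := fun n => measurePreserving_comp (ν := ν) (hσ n) (hν n)
  have hpi := isPiSystem_measurableCylinders (α := fun _ : ι => Bool)
  have hgen := (generateFrom_measurableCylinders (α := fun _ : ι => Bool)).symm
  have hbasic : ∀ A ∈ measurableCylinders (fun _ : ι => Bool),
      ∀ B ∈ measurableCylinders (fun _ : ι => Bool),
      Tendsto (fun n => (Measure.infinitePi ν).real ((fun ω i => ω (σ n i)) ⁻¹' A ∩ B)) atTop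
      (𝓝 ((Measure.infinitePi ν).real A * (Measure.infinitePi ν).real B)) := by
    intro A hA B hB
    obtain ⟨s, S, hS, rfl⟩ := (mem_measurableCylinders _).1 hA
    obtain ⟨t, T, hT, rfl⟩ := (mem_measurableCylinders _).1 hB
    -- Once the shifted base of one cylinder avoids the base of the other, independence makes the
    -- sequence equal to its limit.
    have hev : ∀ᶠ n in atTop, ∀ i ∈ s, ∀ j ∈ t, σ n i ≠ j :=
      (eventually_all_finset s).2 fun i _ => (eventually_all_finset t).2 fun j _ => hmix i j
    refine tendsto_const_nhds.congr' (hev.mono fun n hn => ?_)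
    have hdisj : Disjoint (σ n '' s) t := by
      rw [Set.disjoint_left]
      rintro _ ⟨i, hi, rfl⟩ hj
      exact hn i hi _ hj rfl
    have hind := indep_coordinates ν hdisj
    rw [Indep_iff] at hind
    beta_reduce
    rw [measureReal_def, measureReal_def, measureReal_def, hind, ENNReal.toReal_mul,
      (hmp n).measure_preimage hS.cylinder.nullMeasurableSet]
    · refine @measurable_pi_lambda _ _ _ (coordinates _) _ _ (fun i => ?_) S hS
      exact measurable_coordinates ⟨i, i.2, rfl⟩
    · refine @measurable_pi_lambda _ _ _ (coordinates _) _ _ (fun i => ?_) T hT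
      exact measurable_coordinates i.2
  -- Extend from cylinders one argument at a time: first `A`, with the cylinder `B` fixed. The
  -- pushforward of the restriction to `B` is dominated because the shift preserves the measure.
  have hleft : ∀ {A}, MeasurableSet A → ∀ B ∈ measurableCylinders (fun _ : ι => Bool),
      Tendsto (fun n => (Measure.infinitePi ν).real ((fun ω i => ω (σ n i)) ⁻¹' A ∩ B)) atTop
      (𝓝 ((Measure.infinitePi ν).real A * (Measure.infinitePi ν).real B)) := by
    intro A hA B hB
    have hBm := MeasurableSet.of_mem_measurableCylinders hB
    have := (Measure.infinitePi ν).smul_finite (measure_ne_top (Measure.infinitePi ν) B)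
    have key := tendsto_measureReal_of_piSystem (μ := Measure.infinitePi ν)
      (m := fun n => ((Measure.infinitePi ν).restrict B).map fun ω i => ω (σ n i))
      (ν := Measure.infinitePi ν B • Measure.infinitePi ν) hgen hpi
      (fun n => (Measure.map_mono Measure.restrict_le_self (hmp n).measurable).trans_eq
        (hmp n).map_eq) ?_ (fun C hC => ?_) hA
    · simpa [map_measureReal_apply (hmp _).measurable hA,
        measureReal_restrict_apply ((hmp _).measurable hA), mul_comm, measureReal_ennreal_smul_apply, ← measureReal_def] using key
    · simp [map_measureReal_apply (hmp _).measurable .univ, measureReal_ennreal_smul_apply, ← measureReal_def]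
    · have hC' := MeasurableSet.of_mem_measurableCylinders hC
      simpa [map_measureReal_apply (hmp _).measurable hC',
        measureReal_restrict_apply ((hmp _).measurable hC'), mul_comm, measureReal_ennreal_smul_apply, ← measureReal_def]
        using hbasic C hC B hB
  have := (Measure.infinitePi ν).smul_finite (measure_ne_top (Measure.infinitePi ν) A)
  -- Now `B` is extended, with the measurable set `A` fixed.
  have key := tendsto_measureReal_of_piSystem (μ := Measure.infinitePi ν)
    (m := fun n => (Measure.infinitePi ν).restrict ((fun ω i => ω (σ n i)) ⁻¹' A))
    (ν := Measure.infinitePi ν A • Measure.infinitePi ν) hgen hpi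
    (fun n => Measure.restrict_le_self) ?_ (fun C hC => ?_) hB
  · simpa [measureReal_restrict_apply hB, measureReal_ennreal_smul_apply, ← measureReal_def,
        Set.inter_comm] using key
  · simp [measureReal_def, (hmp _).measure_preimage hA.nullMeasurableSet]
  · have hC' := MeasurableSet.of_mem_measurableCylinders hC
    simpa [measureReal_restrict_apply hC', measureReal_ennreal_smul_apply, ← measureReal_def,
        Set.inter_comm] using hleft hA C hC

end Mixing

/-! ### Percolation of independent lines on a graph with a mixing shift. -/

section Percolation

open Filter Topology

variable {X ι : Type*} (G : SimpleGraph X) (ν : ι → Measure Bool) (L : X → Finset ι)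

/-- The sites all of whose lines are open. -/
def openSites (ω : ι → Bool) : Set X := {x | ∀ i ∈ L x, ω i = true}

/-- The number of infinite clusters of `V`. -/
noncomputable def numInfinite (V : Set X) : ℕ∞ :=
  Set.encard {C : (G.induce V).ConnectedComponent | C.supp.Infinite}

/-- A sequence of commuting automorphisms of the graph acting compatibly on the lines, preserving
the marginals and eventually moving every line away from any other given line. -/
structure MixingShift where
  /-- The automorphisms of the graph. -/
  site : ℕ → G ≃g G
  /-- The action on the lines. -/
  line : ℕ → ι → ι
  line_injective : ∀ n, (line n).Injective
  marginal_line : ∀ n i, ν (line n i) = ν i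
  eventually_line_ne : ∀ i j, ∀ᶠ n in atTop, line n i ≠ j
  site_comm : ∀ m n x, site m (site n x) = site n (site m x)
  mem_lines_site : ∀ n x i, i ∈ L (site n x) ↔ ∃ k ∈ L x, line n k = i

variable {G ν L}

/-- The action of a shift on line configurations. -/
def MixingShift.act (T : MixingShift G ν L) (n : ℕ) (ω : ι → Bool) : ι → Bool :=
  fun i => ω (T.line n i)

theorem MixingShift.openSites_act (T : MixingShift G ν L) (n : ℕ) (ω : ι → Bool) :
    openSites L (T.act n ω) = T.site n ⁻¹' openSites L ω := by
  ext x
  simp [openSites, MixingShift.act, T.mem_lines_site]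

theorem MixingShift.linked_act_iff (T : MixingShift G ν L) (n : ℕ) (ω : ι → Bool) (x y : X) :
    Linked G (openSites L (T.act n ω)) x y ↔
      Linked G (openSites L ω) (T.site n x) (T.site n y) := by
  rw [T.openSites_act, linked_equiv_iff]

theorem MixingShift.mem_infiniteSites_act_iff (T : MixingShift G ν L) (n : ℕ) (ω : ι → Bool)
    (x : X) : x ∈ infiniteSites G (openSites L (T.act n ω)) ↔
      T.site n x ∈ infiniteSites G (openSites L ω) := by
  rw [T.openSites_act, mem_infiniteSites_equiv_iff]

theorem isSeparated_equiv (e : G ≃g G) {V : Set X} {F : Finset X} :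
    IsSeparated G (e ⁻¹' V) F ↔ IsSeparated G V (F.map e.toEquiv.toEmbedding) := by
  simp only [IsSeparated, Finset.mem_map, forall_exists_index, and_imp, forall_apply_eq_imp_iff₂]
  simp [mem_infiniteSites_equiv_iff, linked_equiv_iff]

theorem numInfinite_equiv (e : G ≃g G) (V : Set X) :
    numInfinite G (e ⁻¹' V) = numInfinite G V := by
  refine ENat.eq_of_forall_natCast_le_iff fun n => ?_
  rw [numInfinite, numInfinite, natCast_le_encard_infinite_components_iff,
    natCast_le_encard_infinite_components_iff]
  simp only [isSeparated_equiv]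
  constructor
  · rintro ⟨F, hF, h⟩
    exact ⟨_, by simpa, h⟩
  · rintro ⟨F, hF, h⟩
    refine ⟨F.map e.symm.toEquiv.toEmbedding, by simpa, ?_⟩
    convert h
    ext x
    simp [RelIso.symm]

theorem openSites_subset_openOn (S : Finset ι) (ω : ι → Bool) :
    openSites L ω ⊆ openSites L (openOn S ω) := by
  intro x hx i hi
  by_cases h : i ∈ S
  · simp [openOn, h]
  · simpa [openOn, h] using hx i hi

theorem MixingShift.measurePreserving_act [∀ i, IsProbabilityMeasure (ν i)]
    (T : MixingShift G ν L) (n : ℕ) :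
    MeasurePreserving (T.act n) (Measure.infinitePi ν) (Measure.infinitePi ν) :=
  measurePreserving_comp (T.line_injective n) (T.marginal_line n)

/-- The sites of the infinite clusters which contain only finitely many points of the form
`T.site (j m) y`, for every `y`. -/
def MixingShift.sparseSites (T : MixingShift G ν L) (j : ℕ → ℕ) (ω : ι → Bool) : Set X :=
  {x | x ∈ infiniteSites G (openSites L ω) ∧
    ∀ y, ¬ {m | Linked G (openSites L ω) x (T.site (j m) y)}.Infinite}

/-- Commutation turns the translates of `y` into those of `T.site n y`; the quantifier over all `y`
in `sparseSites` absorbs this change of base point. -/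
theorem MixingShift.mem_sparseSites_act_iff (T : MixingShift G ν L) (j : ℕ → ℕ) (n : ℕ)
    (ω : ι → Bool) (x : X) :
    x ∈ T.sparseSites j (T.act n ω) ↔ T.site n x ∈ T.sparseSites j ω := by
  simp only [sparseSites, Set.mem_ofPred_eq, T.mem_infiniteSites_act_iff, T.linked_act_iff,
    T.site_comm n]
  refine and_congr_right fun _ => ?_
  exact (T.site n).toEquiv.forall_congr fun _ => .rfl

/-- If there are finitely many clusters, only finitely many points of the sequence
`T.site (j m) x` are in infinite clusters that are sparse along that sequence. -/
theorem MixingShift.finite_setOf_mem_sparseSites (T : MixingShift G ν L) (j : ℕ → ℕ) (x : X)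
    {ω : ι → Bool} (hN : numInfinite G (openSites L ω) ≠ ⊤) :
    {m | T.site (j m) x ∈ T.sparseSites j ω}.Finite := by
  by_contra hinf
  have hinf : Set.Infinite _ := hinf
  have hV : ∀ y ∈ T.sparseSites j ω, y ∈ openSites L ω := fun y hy =>
    mem_of_mem_infiniteSites hy.1
  have hfin : {C : (G.induce (openSites L ω)).ConnectedComponent | C.supp.Infinite}.Finite :=
    Set.encard_ne_top_iff.1 hN
  have : Finite {C : (G.induce (openSites L ω)).ConnectedComponent | C.supp.Infinite} := hfin
  have : Infinite {m | T.site (j m) x ∈ T.sparseSites j ω} := hinf.to_subtype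
  let f : {m | T.site (j m) x ∈ T.sparseSites j ω} →
      {C : (G.induce (openSites L ω)).ConnectedComponent | C.supp.Infinite} := fun m =>
    ⟨(G.induce (openSites L ω)).connectedComponentMk ⟨T.site (j m) x, hV _ m.2⟩,
      (supp_infinite_iff _).2 m.2.1⟩
  -- By pigeonhole one sparse cluster contains translates of `x` for infinitely many indices,
  -- against its sparsity. Indices are counted rather than sites, so `j` need not be injective.
  obtain ⟨C, hC⟩ := Finite.exists_infinite_fiber f
  obtain ⟨⟨m₀, hm₀⟩, h₀⟩ := (Set.infinite_coe_iff.1 hC).nonempty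
  refine hm₀.2 x (((Set.infinite_coe_iff.1 hC).image Subtype.val_injective.injOn).mono ?_)
  rintro _ ⟨⟨m, hm⟩, h, rfl⟩
  have h' : f ⟨m₀, hm₀⟩ = f ⟨m, hm⟩ := Eq.trans h₀ h.symm
  exact ⟨_, _, SimpleGraph.ConnectedComponent.eq.1 (congrArg Subtype.val h')⟩

/-! ### Measurability of the cluster events. -/

section Measurability

theorem measurableSet_mem_openSites (x : X) : MeasurableSet {ω | x ∈ openSites L ω} := by
  have : {ω | x ∈ openSites L ω} = allOpen (L x) := rfl
  exact this ▸ measurableSet_allOpen _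

theorem measurableSet_setOf_infinite {Ω Y : Type*} [MeasurableSpace Ω] [Countable Y]
    {P : Ω → Y → Prop} (h : ∀ y, MeasurableSet {ω | P ω y}) :
    MeasurableSet {ω | {y | P ω y}.Infinite} := by
  have : {ω | {y | P ω y}.Infinite} = ⋂ F : Finset Y, ⋃ y : {y // y ∉ F}, {ω | P ω y} := by
    ext ω
    simp only [Set.mem_ofPred_eq, Set.mem_iInter, Set.mem_iUnion, Subtype.exists, exists_prop]
    constructor
    · intro hinf F
      obtain ⟨y, hy, hyF⟩ := hinf.exists_notMem_finset F
      exact ⟨y, hyF, hy⟩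
    · intro hF hfin
      obtain ⟨y, hy, hP⟩ := hF hfin.toFinset
      exact hy (hfin.mem_toFinset.2 hP)
  rw [this]
  exact .iInter fun F => .iUnion fun y => h y

variable [Countable X]

theorem measurableSet_linked (x y : X) : MeasurableSet {ω | Linked G (openSites L ω) x y} := by
  have h : ∀ n y, MeasurableSet {ω | LinkedIn G (openSites L ω) n x y} := by
    intro n
    induction n with
    | zero => exact fun y => (measurableSet_mem_openSites x).inter (.const _)
    | succ n ih =>
      intro y
      simp only [LinkedIn, Set.ofPred_exists]
      exact .iUnion fun z => (ih z).inter ((MeasurableSet.const _).inter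
        (measurableSet_mem_openSites y))
  simp only [linked_iff_exists_linkedIn, Set.ofPred_exists]
  exact .iUnion fun n => h n y

theorem measurableSet_mem_infiniteSites (x : X) :
    MeasurableSet {ω | x ∈ infiniteSites G (openSites L ω)} :=
  measurableSet_setOf_infinite fun y => measurableSet_linked x y

theorem measurableSet_isSeparated (F : Finset X) :
    MeasurableSet {ω | IsSeparated G (openSites L ω) F} := by
  simp only [IsSeparated, Set.ofPred_and, Set.ofPred_forall]
  refine .inter ?_ ?_
  · exact .iInter fun x => .iInter fun _ => measurableSet_mem_infiniteSites x
  · refine .iInter fun x => .iInter fun _ => .iInter fun y => .iInter fun _ => ?_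
    exact (measurableSet_linked x y).imp (.const _)

theorem measurable_numInfinite : Measurable fun ω => numInfinite G (openSites L ω) := by
  have hle : ∀ n : ℕ, MeasurableSet {ω | (n : ℕ∞) ≤ numInfinite G (openSites L ω)} := by
    intro n
    simp only [numInfinite, natCast_le_encard_infinite_components_iff, Set.ofPred_exists]
    exact .iUnion fun F => (MeasurableSet.const _).inter (measurableSet_isSeparated F)
  refine measurable_to_countable' fun c => ?_
  have : (fun ω => numInfinite G (openSites L ω)) ⁻¹' {c} = ⋂ n : ℕ,
      {ω | (n : ℕ∞) ≤ numInfinite G (openSites L ω) ↔ n ≤ c} := by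
    ext ω
    simp only [Set.mem_preimage, Set.mem_singleton_iff, Set.mem_iInter, Set.mem_ofPred_eq]
    exact ⟨fun h n => by rw [h], ENat.eq_of_forall_natCast_le_iff⟩
  rw [this]
  exact .iInter fun n => (hle n).iff (.const _)

theorem MixingShift.measurableSet_mem_sparseSites (T : MixingShift G ν L) (j : ℕ → ℕ) (x : X) :
    MeasurableSet {ω | x ∈ T.sparseSites j ω} := by
  have : {ω | x ∈ T.sparseSites j ω} = {ω | x ∈ infiniteSites G (openSites L ω)} ∩
      ⋂ y, {ω | {m | Linked G (openSites L ω) x (T.site (j m) y)}.Infinite}ᶜ := by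
    ext ω
    simp [sparseSites]
  rw [this]
  exact (measurableSet_mem_infiniteSites x).inter <| .iInter fun y =>
    (measurableSet_setOf_infinite fun m => measurableSet_linked x _).compl

end Measurability

/-! ### Zero-one law and exclusion of finite cluster numbers above one. -/

variable [∀ i, IsProbabilityMeasure (ν i)]

theorem MixingShift.tendsto_measureReal_inter (T : MixingShift G ν L) {A B : Set (ι → Bool)}
    (hA : MeasurableSet A) (hB : MeasurableSet B) :
    Tendsto (fun n => (Measure.infinitePi ν).real (T.act n ⁻¹' A ∩ B)) atTop
      (𝓝 ((Measure.infinitePi ν).real A * (Measure.infinitePi ν).real B)) :=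
  tendsto_measureReal_shift_inter T.line_injective T.marginal_line T.eventually_line_ne hA hB

/-- Mixing applied to the pair `A, A` gives `P(A) = P(A)²`. -/
theorem MixingShift.preErgodic (T : MixingShift G ν L) {A : Set (ι → Bool)}
    (hA : MeasurableSet A) (hinv : ∀ n, T.act n ⁻¹' A = A) :
    (∀ᵐ ω ∂Measure.infinitePi ν, ω ∈ A) ∨ ∀ᵐ ω ∂Measure.infinitePi ν, ω ∉ A := by
  have h := T.tendsto_measureReal_inter hA hA
  simp only [hinv, Set.inter_self] at h
  have h2 := tendsto_nhds_unique h tendsto_const_nhds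
  rcases mul_right_eq_self₀.1 h2 with h1 | h0
  · left
    refine (mem_ae_iff_prob_eq_one hA).2 ?_
    rw [← ofReal_measureReal, h1, ENNReal.ofReal_one]
  · right
    rw [measureReal_eq_zero_iff] at h0
    exact measure_eq_zero_iff_ae_notMem.1 h0

variable [Countable X]

theorem MixingShift.exists_numInfinite_eq (T : MixingShift G ν L) :
    ∃ c, ∀ᵐ ω ∂Measure.infinitePi ν, numInfinite G (openSites L ω) = c := by
  refine exists_eventuallyEq_const_of_forall_separating MeasurableSet fun U hU => ?_
  refine T.preErgodic (measurable_numInfinite hU) fun n => ?_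
  ext ω
  change numInfinite G (openSites L (T.act n ω)) ∈ U ↔ _
  rw [T.openSites_act, numInfinite_equiv]
  rfl

/-- By stationarity the probability that the `m`-th translate of `x` is sparse does not depend on
`m`. Almost surely only finitely many translates are sparse, so these probabilities also tend to
`0`. -/
theorem MixingShift.ae_notMem_sparseSites (T : MixingShift G ν L)
    (hN : ∀ᵐ ω ∂Measure.infinitePi ν, numInfinite G (openSites L ω) ≠ ⊤) (j : ℕ → ℕ) (x : X) :
    ∀ᵐ ω ∂Measure.infinitePi ν, x ∉ T.sparseSites j ω := by
  have hconst : ∀ m, Measure.infinitePi ν {ω | T.site (j m) x ∈ T.sparseSites j ω} =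
      Measure.infinitePi ν {ω | x ∈ T.sparseSites j ω} := by
    intro m
    rw [← (T.measurePreserving_act (j m)).measure_preimage
      (T.measurableSet_mem_sparseSites j x).nullMeasurableSet]
    simp only [Set.preimage_ofPred_eq, T.mem_sparseSites_act_iff]
  have hlim := tendsto_measure_of_ae_tendsto_indicator_of_isFiniteMeasure atTop
    (μ := Measure.infinitePi ν) (As := fun m => {ω | T.site (j m) x ∈ T.sparseSites j ω})
    .empty (fun m => T.measurableSet_mem_sparseSites j _) <| by
      filter_upwards [hN] with ω hω
      have := T.finite_setOf_mem_sparseSites j x hω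
      filter_upwards [Nat.cofinite_eq_atTop ▸ this.compl_mem_cofinite] with m hm
      simpa using hm
  simp only [hconst, measure_empty] at hlim
  exact measure_eq_zero_iff_ae_notMem.1 (tendsto_nhds_unique tendsto_const_nhds hlim)

/-- Opening finitely many lines does not change the density of the infinite clusters. -/
theorem MixingShift.tendsto_measureReal_new (T : MixingShift G ν L) (hpos : ∀ i, ν i {true} ≠ 0)
    (S : Finset ι) (y : X) :
    Tendsto (fun n => (Measure.infinitePi ν).real
      ({ω | T.site n y ∈ infiniteSites G (openSites L (openOn S ω))} \
        {ω | T.site n y ∈ infiniteSites G (openSites L ω)})) atTop (𝓝 0) := by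
  set P := Measure.infinitePi ν
  set A := {ω | y ∈ infiniteSites G (openSites L ω)}
  have hA : MeasurableSet A := measurableSet_mem_infiniteSites y
  have hAn : ∀ n, {ω | T.site n y ∈ infiniteSites G (openSites L ω)} = T.act n ⁻¹' A := by
    intro n; ext ω; exact (T.mem_infiniteSites_act_iff n ω y).symm
  have hAm : ∀ n, MeasurableSet (T.act n ⁻¹' A) := fun n =>
    (T.measurePreserving_act n).measurable hA
  have hS : P.real (allOpen S) ≠ 0 :=
    (measureReal_ne_zero_iff).2 (measure_allOpen_ne_zero hpos S)
  -- The difference is the conditional probability of the shifted event given `allOpen S`, minus its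
  -- unconditional probability; mixing makes it vanish in the limit.
  have h1 : ∀ n, P.real ({ω | T.site n y ∈ infiniteSites G (openSites L (openOn S ω))} \
      {ω | T.site n y ∈ infiniteSites G (openSites L ω)}) =
      P.real (T.act n ⁻¹' A ∩ allOpen S) / P.real (allOpen S) - P.real A := by
    intro n
    have hsub : {ω | T.site n y ∈ infiniteSites G (openSites L ω)} ⊆
        {ω | T.site n y ∈ infiniteSites G (openSites L (openOn S ω))} :=
      fun ω h => infiniteSites_mono (openSites_subset_openOn S ω) h
    rw [measureReal_sdiff hsub
      (measurableSet_mem_infiniteSites _), hAn,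
      (T.measurePreserving_act n).measureReal_preimage hA.nullMeasurableSet]
    congr 1
    rw [eq_div_iff hS]
    have := measure_openOn_preimage_mul (ν := ν) S (hAm n)
    rw [← hAn] at this ⊢
    simp only [measureReal_def, ← ENNReal.toReal_mul]
    exact congrArg _ this
  simp only [h1]
  have := ((T.tendsto_measureReal_inter hA (measurableSet_allOpen S)).div_const
    (P.real (allOpen S))).sub_const (P.real A)
  rwa [mul_div_cancel_right₀ _ hS, sub_self] at this

/-- A countable family of sequences tending to zero has a common summable subsequence. -/
theorem exists_forall_summable_comp {Y : Type*} [Countable Y] {a : Y → ℕ → ℝ}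
    (h : ∀ y, Tendsto (a y) atTop (𝓝 0)) : ∃ j : ℕ → ℕ, ∀ y, Summable fun m => a y (j m) := by
  have := Encodable.ofCountable Y
  have hfin : ∀ m, {y : Y | Encodable.encode y ≤ m}.Finite := fun m =>
    (Set.finite_Iic m).preimage Encodable.encode_injective.injOn
  -- Stage `m` treats only the finitely many `y` with code at most `m`, so each `y` obeys the
  -- geometric bound from its own code onwards.
  have : ∀ m : ℕ, ∃ n, ∀ y ∈ (hfin m).toFinset, |a y n| < (1 / 2 : ℝ) ^ m := by
    intro m
    refine ((eventually_all_finset _).2 fun y _ => ?_).exists (f := atTop)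
    have := (h y).abs
    rw [abs_zero] at this
    exact this.eventually_lt_const (by positivity)
  choose j hj using this
  refine ⟨j, fun y => .of_norm_bounded_eventually_nat summable_geometric_two ?_⟩
  filter_upwards [eventually_ge_atTop (Encodable.encode y)] with m hm
  exact (hj m y (by simpa using hm)).le

theorem MixingShift.ae_finite_new (T : MixingShift G ν L) (hpos : ∀ i, ν i {true} ≠ 0)
    (S : Finset ι) : ∃ j : ℕ → ℕ, ∀ᵐ ω ∂Measure.infinitePi ν, ∀ y,
      {m | T.site (j m) y ∈ infiniteSites G (openSites L (openOn S ω)) ∧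
        T.site (j m) y ∉ infiniteSites G (openSites L ω)}.Finite := by
  obtain ⟨j, hj⟩ := exists_forall_summable_comp (T.tendsto_measureReal_new hpos S)
  refine ⟨j, ae_all_iff.2 fun y => ?_⟩
  refine ae_finite_setOfPred_mem (μ := Measure.infinitePi ν)
    (s := fun m => {ω | T.site (j m) y ∈ infiniteSites G (openSites L (openOn S ω))} \
        {ω | T.site (j m) y ∈ infiniteSites G (openSites L ω)}) ?_
  convert (hj y).tsum_ofReal_ne_top with m
  exact (ofReal_measureReal (by finiteness)).symm

theorem MixingShift.not_ae_numInfinite_eq (T : MixingShift G ν L) (hpos : ∀ i, ν i {true} ≠ 0)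
    (hG : G.Preconnected) {k : ℕ} (hk : 2 ≤ k) :
    ¬ ∀ᵐ ω ∂Measure.infinitePi ν, numInfinite G (openSites L ω) = k := by
  classical
  intro hN
  -- There are countably many finite sets of sites, so one deterministic `F` is separated with
  -- positive probability.
  have hne : ∃ F : Finset X, F.card = k ∧
      ¬ ∀ᵐ ω ∂Measure.infinitePi ν, ¬ IsSeparated G (openSites L ω) F := by
    by_contra! h
    have h' : ∀ᵐ ω ∂Measure.infinitePi ν, ∀ F : Finset X, F.card = k →
        ¬ IsSeparated G (openSites L ω) F :=
      ae_all_iff.2 fun F => Filter.eventually_imp_distrib_left.2 (h F)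
    obtain ⟨ω, h1, h2⟩ := (hN.and h').exists
    obtain ⟨F, hF, hs⟩ := (natCast_le_encard_infinite_components_iff k).1 h1.ge
    exact h2 F hF hs
  obtain ⟨F, hFk, hF⟩ := hne
  obtain ⟨x₀, hx₀⟩ : F.Nonempty := Finset.card_pos.1 (by omega)
  let w : ∀ x, G.Walk x₀ x := fun x => (hG x₀ x).some
  -- All lines through the sites of fixed paths from `x₀` to the points of `F`; opening them joins
  -- `F` whatever the configuration.
  let S : Finset ι := F.biUnion fun x => (w x).support.toFinset.biUnion L
  have hlink : ∀ ω, ∀ x ∈ F, Linked G (openSites L (openOn S ω)) x₀ x := by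
    refine fun ω x hx => linked_of_walk (w x) fun z hz i hi => ?_
    have : i ∈ S := Finset.mem_biUnion.2 ⟨x, hx, Finset.mem_biUnion.2
      ⟨z, List.mem_toFinset.2 hz, hi⟩⟩
    simp [openOn, this]
  obtain ⟨j, hj⟩ := T.ae_finite_new hpos S
  have hopen : ∀ {Q : (ι → Bool) → Prop}, MeasurableSet {ω | Q ω} →
      (∀ᵐ ω ∂Measure.infinitePi ν, Q ω) → ∀ᵐ ω ∂Measure.infinitePi ν, Q (openOn S ω) :=
    fun hQ h => measure_eq_zero_of_openOn_preimage hpos S hQ.compl h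
  have hN' := hopen (measurable_numInfinite (measurableSet_singleton _)) hN
  have hsparse := ae_all_iff.2 fun x => hopen (T.measurableSet_mem_sparseSites j x).compl
    (T.ae_notMem_sparseSites (hN.mono fun ω h => h ▸ ENat.natCast_ne_top k) j x)
  refine hF ?_
  filter_upwards [hN, hN', hj, hsparse] with ω h1 h2 h3 h4 hsep
  have hall : ∀ x ∈ infiniteSites G (openSites L ω),
      Linked G (openSites L (openOn S ω)) x₀ x := by
    intro x hx
    obtain ⟨y, hy, hxy⟩ : ∃ y ∈ F, Linked G (openSites L ω) x y := by
      -- A further infinite cluster missing `F` would give `k + 1` separated sites.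
      by_contra! h
      have hxF : x ∉ F := fun hxF => h x hxF (.refl (mem_of_mem_infiniteSites hx))
      have := (natCast_le_encard_infinite_components_iff (k + 1)).2
        ⟨insert x F, by rw [Finset.card_insert_of_notMem hxF, hFk], hsep.insert hx h⟩
      rw [← numInfinite, h1] at this
      have := Nat.cast_le.1 this
      omega
    exact (hlink ω y hy).trans (hxy.symm.mono (openSites_subset_openOn S ω))
  obtain ⟨F', hF'k, hF'⟩ := (natCast_le_encard_infinite_components_iff k).1 h2.ge
  -- Since `k ≥ 2`, some infinite cluster after opening avoids `x₀`, and by `hall` it contains no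
  -- site that was in an infinite cluster before.
  obtain ⟨x, hx, hx'⟩ : ∃ x ∈ F', ¬ Linked G (openSites L (openOn S ω)) x₀ x := by
    by_contra! h
    obtain ⟨a, ha, b, hb, hab⟩ := Finset.one_lt_card.1 (show 1 < F'.card by omega)
    exact hab (hF'.2 a ha b hb ((h a ha).symm.trans (h b hb)))
  -- Every translate in the cluster of `x` is newly infinite, so `h3` makes this cluster sparse
  -- along `j`, which `h4` forbids.
  refine h4 x ⟨hF'.1 x hx, fun y => Set.not_infinite.2 ((h3 y).subset fun m hm => ?_)⟩
  exact ⟨hm.mem_infiniteSites (hF'.1 x hx), fun h => hx' ((hall _ h).trans hm.symm)⟩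

/-- A mixing percolation model obtained from independent lines, each open with positive
probability, has almost surely `0`, `1` or infinitely many infinite clusters. -/
theorem MixingShift.exists_numInfinite_eq_zero_one_top (T : MixingShift G ν L)
    (hpos : ∀ i, ν i {true} ≠ 0) (hG : G.Preconnected) :
    ∃ c ∈ ({0, 1, ⊤} : Set ℕ∞),
      ∀ᵐ ω ∂Measure.infinitePi ν, numInfinite G (openSites L ω) = c := by
  obtain ⟨c, hc⟩ := T.exists_numInfinite_eq
  refine ⟨c, ?_, hc⟩
  induction c using ENat.recTopCoe with
  | top => simp
  | coe k =>
    have : k < 2 := by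
      by_contra! hk
      exact T.not_ae_numInfinite_eq hpos hG hk hc
    interval_cases k <;> simp

end Percolation

/-! ### The lattice, its lines and the diagonal translations. -/

section Lattice

open Filter

variable {d : ℕ}

theorem adj_add_single (v : Fin d → ℤ) (i : Fin d) :
    (latticeGraph d).Adj v (v + Pi.single i 1) := by
  classical
  change ∑ j, |v j - (v + Pi.single i 1 : Fin d → ℤ) j| = 1
  rw [Finset.sum_eq_single i] <;> simp +contextual

theorem preconnected_latticeGraph (d : ℕ) : (latticeGraph d).Preconnected := by
  have hstep : ∀ (i : Fin d) (z : ℤ) (v : Fin d → ℤ),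
      (latticeGraph d).Reachable v (v + Pi.single i z) := by
    intro i z v
    induction z with
    | zero => simp
    | succ n ih =>
      refine ih.trans ?_
      rw [Pi.single_add, ← add_assoc]
      exact (adj_add_single _ i).reachable
    | pred n ih =>
      refine ih.trans (SimpleGraph.Reachable.symm ?_)
      have h := (adj_add_single (v + Pi.single i (-(n : ℤ) - 1)) i).reachable
      rwa [add_assoc, ← Pi.single_add, sub_add_cancel] at h
  have hsum : ∀ (s : Finset (Fin d)) (v w : Fin d → ℤ),
      (latticeGraph d).Reachable v (v + ∑ i ∈ s, Pi.single i (w i)) := by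
    intro s v w
    induction s using Finset.induction_on with
    | empty => simp
    | insert i s hi ih =>
      rw [Finset.sum_insert hi, add_comm (Pi.single i (w i) : Fin d → ℤ), ← add_assoc]
      exact ih.trans (hstep i _ _)
  intro v w
  have h := hsum Finset.univ v (w - v)
  rwa [Finset.univ_sum_single, add_sub_cancel] at h

/-- Translation by the vector all of whose coordinates are `n`. -/
def diagonalShift (d n : ℕ) : latticeGraph d ≃g latticeGraph d where
  toEquiv := Equiv.addRight fun _ => (n : ℤ)
  map_rel_iff' := by simp [latticeGraph]

/-- The lines of the lattice. -/
abbrev Line (d : ℕ) : Type := (i : Fin d) × Hyperplane d i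

/-- The lines through a site. -/
def linesThrough (v : Fin d → ℤ) : Finset (Line d) :=
  Finset.univ.map ⟨fun i => ⟨i, proj i v⟩, fun _ _ h => congrArg Sigma.fst h⟩

theorem mem_linesThrough {v : Fin d → ℤ} {l : Line d} :
    l ∈ linesThrough v ↔ l.2 = proj l.1 v := by
  obtain ⟨i, w⟩ := l
  simp only [linesThrough, Finset.mem_map, Finset.mem_univ, true_and]
  constructor
  · rintro ⟨j, h⟩
    obtain ⟨rfl, h⟩ := Sigma.mk.inj h
    exact (eq_of_heq h).symm
  · rintro h
    exact ⟨i, congrArg (Sigma.mk i) h.symm⟩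

/-- The action of the diagonal translation on lines. -/
def lineShift (n : ℕ) (l : Line d) : Line d := ⟨l.1, proj l.1 fun j => l.2.1 j + n⟩

theorem proj_eq_proj_iff {i : Fin d} {v w : Fin d → ℤ} :
    proj i v = proj i w ↔ ∀ j ≠ i, v j = w j := by
  rw [proj, proj, Subtype.mk.injEq]
  constructor
  · intro h j hj
    simpa [hj] using congrFun h j
  · intro h
    ext j
    by_cases hj : j = i
    · subst hj; simp
    · simp [hj, h j hj]

theorem proj_coe {i : Fin d} (w : Hyperplane d i) : proj i w.1 = w := by
  ext j
  by_cases hj : j = i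
  · subst hj; simp [proj, w.2]
  · simp [proj, hj]

theorem lineShift_injective (n : ℕ) : (lineShift (d := d) n).Injective := by
  rintro ⟨i, v⟩ ⟨j, w⟩ h
  obtain ⟨rfl, h⟩ := Sigma.mk.inj h
  rw [← proj_coe v, ← proj_coe w, Sigma.mk.injEq, heq_eq_eq, proj_eq_proj_iff]
  refine ⟨rfl, fun j hj => ?_⟩
  exact add_right_cancel (proj_eq_proj_iff.1 (eq_of_heq h) j hj)

/-- The diagonal translations form a mixing shift for line percolation. -/
def diagonalMixingShift (hd : 2 ≤ d) (p : Fin d → unitInterval) :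
    MixingShift (latticeGraph d)
      (fun l : Line d => bernoulliMeasure true false (p l.1)) linesThrough where
  site := diagonalShift d
  line := lineShift
  line_injective := lineShift_injective
  marginal_line _ _ := rfl
  eventually_line_ne l l' := by
    have : Nontrivial (Fin d) := Fin.nontrivial_iff_two_le.2 hd
    -- A line is determined by its coordinates off its own direction. One such coordinate `j` exists
    -- as `d ≥ 2`, and the diagonal translation moves it by `n`, eventually past that of `l'`.
    obtain ⟨j, hj⟩ := exists_ne l.1
    filter_upwards [eventually_gt_atTop (l'.2.1 j - l.2.1 j).toNat] with n hn h
    subst h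
    simp [lineShift, proj, hj] at hn
  site_comm m n x := by
    ext j
    change x j + n + m = x j + m + n
    ring
  mem_lines_site n v l := by
    obtain ⟨i, w⟩ := l
    rw [mem_linesThrough]
    constructor
    · intro h
      change w = proj i (fun j => v j + n) at h
      refine ⟨⟨i, proj i v⟩, mem_linesThrough.2 rfl, ?_⟩
      rw [h, lineShift, Sigma.mk.injEq, heq_eq_eq, proj_eq_proj_iff]
      exact ⟨rfl, fun j hj => by simp [proj, hj]⟩
    · rintro ⟨⟨j, u⟩, hu, h⟩
      obtain ⟨rfl, h⟩ := Sigma.mk.inj h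
      rw [mem_linesThrough] at hu
      rw [← eq_of_heq h]
      refine proj_eq_proj_iff.2 fun k hk => ?_
      change u.1 k + n = v k + n
      dsimp only at hu
      simp [hu, proj, hk]

theorem map_piCurry_infinitePi_eq_lineMeasure (p : Fin d → unitInterval) :
    (Measure.infinitePi fun l : Line d => bernoulliMeasure true false (p l.1)).map
      (MeasurableEquiv.piCurry fun (i : Fin d) (_ : Hyperplane d i) => Bool) = lineMeasure d p := by
  rw [Measure.infinitePi_map_piCurry
    (fun (i : Fin d) (_ : Hyperplane d i) => bernoulliMeasure true false (p i)), lineMeasure,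
    Measure.infinitePi_eq_pi]

theorem vacantSet_siteConfig_piCurry (ω : Line d → Bool) :
    vacantSet (siteConfig (MeasurableEquiv.piCurry
      (fun (i : Fin d) (_ : Hyperplane d i) => Bool) ω)) = openSites linesThrough ω := by
  ext v
  simp only [vacantSet, siteConfig, openSites, Set.mem_ofPred_eq, decide_eq_true_eq,
    mem_linesThrough]
  constructor
  · rintro h ⟨i, w⟩ hw
    obtain rfl : w = proj i v := hw
    exact h i
  · exact fun h i => h ⟨i, proj i v⟩ rfl

theorem ae_bernoulliLinePercolation_of_ae {p : Fin d → unitInterval} {c : ℕ∞}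
    (h : ∀ᵐ ω ∂Measure.infinitePi fun l : Line d => bernoulliMeasure true false (p l.1),
      numInfinite (latticeGraph d) (openSites linesThrough ω) = c) :
    ∀ᵐ η ∂bernoulliLinePercolation d p, numInfiniteClusters η = c := by
  -- Site configurations are the special case in which each site is its own only line, so the
  -- measurability of `numInfinite` applies to them too.
  have hvac : ∀ η : (Fin d → ℤ) → Bool, vacantSet η = openSites (fun v => {v}) η := by
    intro η; ext v; simp [vacantSet, openSites]
  have hmeas : Measurable fun η : (Fin d → ℤ) → Bool => numInfiniteClusters η := by
    have := measurable_numInfinite (G := latticeGraph d) (L := fun v => {v})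
    simp only [← hvac] at this
    exact this
  rw [bernoulliLinePercolation, ← map_piCurry_infinitePi_eq_lineMeasure,
    ae_map_iff (p := fun η => numInfiniteClusters η = c) (measurable_siteConfig d).aemeasurable
      (hmeas (measurableSet_singleton c)),
    ae_map_iff (p := fun ω => numInfiniteClusters (siteConfig ω) = c)
      (MeasurableEquiv.measurable _).aemeasurable
      ((hmeas.comp (measurable_siteConfig d)) (measurableSet_singleton c))]
  filter_upwards [h] with ω hω
  rw [← hω, ← vacantSet_siteConfig_piCurry]
  rfl

theorem ae_openSites_eq_empty {p : Fin d → unitInterval} {i : Fin d} (hi : p i = 0) :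
    ∀ᵐ ω ∂Measure.infinitePi fun l : Line d => bernoulliMeasure true false (p l.1),
      openSites linesThrough ω = ∅ := by
  have h : ∀ v : Fin d → ℤ,
      ∀ᵐ ω ∂Measure.infinitePi fun l : Line d => bernoulliMeasure true false (p l.1),
        ω ⟨i, proj i v⟩ ≠ true := by
    intro v
    refine (measurePreserving_eval_infinitePi
      (fun l : Line d => bernoulliMeasure true false (p l.1))
      ⟨i, proj i v⟩).quasiMeasurePreserving.ae (p := fun b : Bool => b ≠ true) ?_
    simp [hi]
  filter_upwards [ae_all_iff.2 h] with ω hω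
  refine Set.eq_empty_of_forall_notMem fun v hv => hω v (hv _ (mem_linesThrough.2 rfl))

end Lattice

end LinePercolation

/-- For Bernoulli line percolation, the number of infinite vacant clusters is almost surely equal
to a constant belonging to `{0, 1, ∞}`. -/
theorem theorem4 (d : ℕ) (hd : 3 ≤ d) (p : Fin d → unitInterval) :
    ∃ c ∈ ({0, 1, ⊤} : Set ℕ∞),
      ∀ᵐ η ∂(LinePercolation.bernoulliLinePercolation d p),
        LinePercolation.numInfiniteClusters η = c := by
  open LinePercolation in
  by_cases hp : ∃ i, p i = 0
  · obtain ⟨i, hi⟩ := hp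
    refine ⟨0, by simp, ae_bernoulliLinePercolation_of_ae ?_⟩
    filter_upwards [ae_openSites_eq_empty hi] with ω hω
    rw [hω, numInfinite, Set.encard_eq_zero]
    refine Set.eq_empty_of_forall_notMem fun C _ => C.out.2.elim
  · push Not at hp
    have hpos : ∀ l : Line d, bernoulliMeasure true false (p l.1) {true} ≠ 0 := by
      intro l
      have : unitInterval.toNNReal (p l.1) ≠ 0 := fun h =>
        hp l.1 (Subtype.ext (congrArg NNReal.toReal h))
      simpa [bernoulliMeasure_def] using this
    obtain ⟨c, hc, h⟩ := (diagonalMixingShift (by omega) p).exists_numInfinite_eq_zero_one_top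
      hpos (preconnected_latticeGraph d)
    exact ⟨c, hc, ae_bernoulliLinePercolation_of_ae h⟩
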